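/- Let $q$ be a prime power and let $k,u,h$ be integers with $u\ge 2$, $h\ge 1$, $k\ge hu$ and $q^k-q^{k-1}>h(q^u-1)$. Let $i_h$ be the least index of a nonzero digit in the base-$q$ expansion of $h$, and assume that $i_h+u>\sum_{i=1}^{k-u}\lfloor h/q^i\rfloor$. Let $U_1,\dots,U_h$ be subspaces of $\mathbf F_q^k$, each spanned by $u$ of the standard basis vectors, with $U_i\cap U_j=\{0\}$ for $i\ne j$ (such subspaces exist because $k\ge hu$). Choose one vector from each class $\{\lambda v:\lambda\in\mathbf F_q^*\}$ with $v\in\mathbf F_q^k\setminus(U_1\cup\dots\cup U_h)$, let $\widetilde G$ be a matrix whose columns are the chosen vectors, and let $\mathbf C_1=\{x\widetilde G: x\in\mathbf F_q^k\}$. Then, for every choice of the $U_i$ and of the representatives, $\mathbf C_1$ is a linear $[n,k,d]_q$ code with $$n=\frac{(q^k-1)-h(q^u-1)}{q-1},\qquad d=q^{k-1}-hq^{u-1},$$ and it is optimal, that is, there is no linear $[n,k,d+1]_q$ code. Moreover: (a) The weight distribution of $\mathbf C_1$ is as follows. There is exactly one codeword of weight $0$. For $0\le x\le h-1$, exactly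 $\binom hx (q^u-1)^{h-x}q^{k-hu}$ codewords have weight $q^{k-1}-(h-x)q^{u-1}$. Exactly $q^{k-hu}-1$ codewords have weight $q^{k-1}$. No other weights occur. (b) For $1\le r\le k$ let $d_r(\mathbf C_1)$ be the minimum of $|\mathrm{supp}(D)|$ over the $r$-dimensional linear subcodes $D$ of $\mathbf C_1$, where $\mathrm{supp}(D)$ is the set of positions at which some word of $D$ is nonzero. Then $$d_r(\mathbf C_1)=\begin{cases}\dfrac{(q^k-q^{k-r})-h(q^u-q^{u-r})}{q-1}, & 1\le r\le u,\\[2mm] \dfrac{(q^k-q^{k-r})-h(q^u-1)}{q-1}, & u\le r\le k.\end{cases}$$ -/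

import Mathlib

/-- `i_h`: the least index of a nonzero digit in the base `q` expansion of `h`
(used for `0 < h` and `2 ≤ q` only). -/
noncomputable def lowestNonzeroDigit (q h : ℕ) : ℕ :=
  sInf {i : ℕ | (Nat.digits q h).getD i 0 ≠ 0}

/-- The coordinate subspace of `F ^ k` spanned by the standard basis vectors `e_j`, `j ∈ S`. -/
def coordSubspace (F : Type*) [Field F] {k : ℕ} (S : Finset (Fin k)) :
    Submodule F (Fin k → F) :=
  Submodule.span F ((fun j : Fin k => (Pi.single j 1 : Fin k → F)) '' (S : Set (Fin k)))

/-- `U 0, …, U (h - 1)` are `u`-dimensional coordinate subspaces of `F ^ k` with pairwise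
trivial intersection. -/
def IsCoordFamily {F : Type*} [Field F] {k h : ℕ} (u : ℕ)
    (U : Fin h → Submodule F (Fin k → F)) : Prop :=
  (∀ i, ∃ S : Finset (Fin k), S.card = u ∧ U i = coordSubspace F S) ∧
    ∀ i j, i ≠ j → U i ⊓ U j = ⊥

/-- The nonzero vectors of `F ^ k` outside the union of the subspaces `U i`. -/
def outsideVectors {F : Type*} [Field F] {k h : ℕ}
    (U : Fin h → Submodule F (Fin k → F)) : Set (Fin k → F) :=
  {v | v ≠ 0 ∧ ∀ i, v ∉ U i}

/-- The columns of `G` consist of exactly one vector from each class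
`{c • v | c ≠ 0}`, `v ∈ T`. -/
def PicksOneFromEachClass {F : Type*} [Field F] {k n : ℕ}
    (G : Matrix (Fin k) (Fin n) F) (T : Set (Fin k → F)) : Prop :=
  (∀ j, (fun i => G i j) ∈ T) ∧
    ∀ v ∈ T, ∃! j : Fin n, ∃ c : F, c ≠ 0 ∧ v = c • (fun i => G i j)

/-- The linear code `{x G | x ∈ F ^ k}` generated by the rows of `G`. -/
def codeOfMatrix {F : Type*} [Field F] {k n : ℕ} (G : Matrix (Fin k) (Fin n) F) :
    Submodule F (Fin n → F) :=
  LinearMap.range (Matrix.vecMulLinear G)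

/-- The minimum distance of a code: the least Hamming distance of two distinct codewords
(`0` by convention for the zero code). -/
noncomputable def codeMinDist {F : Type*} [Field F] [DecidableEq F] {n : ℕ}
    (C : Submodule F (Fin n → F)) : ℕ :=
  sInf {s | ∃ a ∈ C, ∃ b ∈ C, a ≠ b ∧ hammingDist a b = s}

/-- `C` is a linear `[n, k, d]` code over `F`. -/
def IsLinearCode {F : Type*} [Field F] [DecidableEq F] {n : ℕ}
    (C : Submodule F (Fin n → F)) (k d : ℕ) : Prop :=
  Module.finrank F C = k ∧ codeMinDist C = d

/-- `C` is an optimal linear `[n, k, d]` code over `F`: it is a linear `[n, k, d]` code, and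
there is no linear `[n, k, d + 1]` code over `F`. -/
def IsOptimalLinearCode {F : Type*} [Field F] [DecidableEq F] {n : ℕ}
    (C : Submodule F (Fin n → F)) (k d : ℕ) : Prop :=
  IsLinearCode C k d ∧ ¬ ∃ C' : Submodule F (Fin n → F), IsLinearCode C' k (d + 1)

/-- The number `A_w(C)` of codewords of Hamming weight `w`. -/
noncomputable def weightMultiplicity {F : Type*} [Field F] [DecidableEq F] {n : ℕ}
    (C : Submodule F (Fin n → F)) (w : ℕ) : ℕ :=
  Set.ncard {c : Fin n → F | c ∈ C ∧ hammingNorm c = w}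

/-- The support of a (sub)code: the positions at which some codeword is nonzero. -/
def codeSupport {F : Type*} [Field F] {n : ℕ} (D : Submodule F (Fin n → F)) : Set (Fin n) :=
  {i | ∃ a ∈ D, a i ≠ 0}

/-- The `r`-th generalized Hamming weight `d_r(C)`: the least support size of an
`r`-dimensional linear subcode of `C` (meaningful for `1 ≤ r ≤ dim C`). -/
noncomputable def genHammingWeight {F : Type*} [Field F] {n : ℕ}
    (C : Submodule F (Fin n → F)) (r : ℕ) : ℕ :=
  sInf {s | ∃ D : Submodule F (Fin n → F),
    D ≤ C ∧ Module.finrank F D = r ∧ (codeSupport D).ncard = s}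

/-! Write b(x) for the number of blocks on which x is nonzero (`blockWeight`). For x ≠ 0, the
functional x · v is nonzero at (q-1)q^(k-1) vectors of F^k, and at (q-1)q^(u-1) vectors of each
block on which x does not vanish. The blocks meet only in 0, so subtracting and dividing by the q-1
scalars gives wt(xG) = q^(k-1) - q^(u-1) b(x) (`hammingNorm_vecMul_add`). The gap hypothesis makes
this positive, so encoding is injective. The minimum distance comes from b(x) = h, and the weight
distribution from counting the x with given b(x) (`card_blockWeight_eq`).

For the generalized weights, summing the weight formula over a subspace X expresses the support size
through the dimensions of the kernels of the restrictions of X to the blocks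
(`encodedSupportCard_formula`). These kernels have dimension at least r - u, and a diagonal
construction attains equality in all blocks at once.

For optimality, `griesmer_bound` at distance d + 1 would require length at least the sum of ⌊d/q^i⌋
+ 1 over i < k. That sum equals n + u - ∑ ⌊(h-1)/q^t⌋, with t from 1 to k - u (`sum_griesmer_add`).
Replacing h by h - 1 lowers ∑ ⌊h/q^t⌋ by at least i_h, so the hypothesis on i_h + u makes the
required length exceed n. -/

/-! ### Averaging and the Griesmer bound -/

/-- The number of positions in `J` at which `v` is nonzero. -/
def weightOn {ι F : Type*} [Zero F] [DecidableEq F] (J : Finset ι) (v : ι → F) : ℕ :=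
  (J.filter fun j => v j ≠ 0).card

/-- A nonzero functional on a finite space is nonzero at a fraction `(q - 1) / q` of the
vectors. -/
theorem card_mul_card_functional_ne_zero {F V : Type*} [Field F] [Fintype F] [DecidableEq F]
    [AddCommGroup V] [Module F V] [Fintype V] (φ : V →ₗ[F] F) (hφ : φ ≠ 0) :
    Fintype.card F * (Finset.univ.filter fun v => φ v ≠ 0).card =
      (Fintype.card F - 1) * Fintype.card V := by
  classical
  -- Count pairs (v, a) with φ(v + a w) ≠ 0: each v excludes exactly one a, and for each a
  -- translation by a w is a bijection.
  obtain ⟨w, hw⟩ : ∃ w, φ w = 1 := LinearMap.surjective hφ 1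
  have h1 : ∀ v : V, (Finset.univ.filter fun a : F => φ (v + a • w) ≠ 0).card =
      Fintype.card F - 1 := by
    intro v
    have : (Finset.univ.filter fun a : F => φ (v + a • w) ≠ 0) = Finset.univ.erase (-φ v) := by
      ext a
      simp only [map_add, map_smul, hw, smul_eq_mul, mul_one, Finset.mem_filter,
        Finset.mem_univ, true_and, Finset.mem_erase, and_true]
      rw [Ne, Ne, add_comm, ← eq_neg_iff_add_eq_zero]
    rw [this, Finset.card_erase_of_mem (Finset.mem_univ _), Finset.card_univ]
  have h2 : ∀ a : F, (Finset.univ.filter fun v : V => φ (v + a • w) ≠ 0).card =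
      (Finset.univ.filter fun v => φ v ≠ 0).card := by
    intro a
    refine Finset.card_bij (fun v _ => v + a • w) ?_ ?_ ?_
    · intro v hv; simpa using hv
    · intro v _ v' _ h; simpa using h
    · intro v hv; exact ⟨v - a • w, by simpa using hv, by simp⟩
  have h3 := Finset.sum_card_bipartiteAbove_eq_sum_card_bipartiteBelow
    (s := (Finset.univ : Finset V)) (t := (Finset.univ : Finset F))
    (fun v a => φ (v + a • w) ≠ 0)
  simp only [Finset.bipartiteAbove, Finset.bipartiteBelow, h1, h2, Finset.sum_const,
    Finset.card_univ, smul_eq_mul] at h3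
  rw [← h3, mul_comm]

/-- The averaging step of the Griesmer bound: restricting to the complement of the support
of a word of minimum weight. -/
theorem weightOn_le_card_mul_weightOn_residual {ι F : Type*} [Field F] [Fintype F]
    [DecidableEq F] (J : Finset ι) (c w : ι → F)
    (hmin : ∀ a : F, weightOn J c ≤ weightOn J (w + a • c)) :
    weightOn J c ≤ Fintype.card F * weightOn (J.filter fun j => c j = 0) w := by
  classical
  have key : ∑ a : F, weightOn J (w + a • c) =
      (Fintype.card F - 1) * weightOn J c +
        Fintype.card F * weightOn (J.filter fun j => c j = 0) w := by
    have h3 := Finset.sum_card_bipartiteAbove_eq_sum_card_bipartiteBelow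
      (s := (Finset.univ : Finset F)) (t := J) (fun a j => (w + a • c) j ≠ 0)
    simp only [Finset.bipartiteAbove, Finset.bipartiteBelow] at h3
    unfold weightOn
    rw [h3, ← Finset.sum_filter_add_sum_filter_not J (fun j => c j ≠ 0)]
    congr 1
    · rw [Finset.sum_congr rfl (g := fun _ => Fintype.card F - 1), Finset.sum_const,
        smul_eq_mul, mul_comm]
      intro j hj
      have hj' : c j ≠ 0 := (Finset.mem_filter.1 hj).2
      have : (Finset.univ.filter fun a : F => (w + a • c) j ≠ 0) =
          Finset.univ.erase (-(w j / c j)) := by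
        ext a
        simp only [Pi.add_apply, Pi.smul_apply, smul_eq_mul, Finset.mem_filter,
          Finset.mem_univ, true_and, Finset.mem_erase, and_true]
        refine not_congr ⟨fun h => ?_, fun h => ?_⟩
        · field_simp; linear_combination h
        · rw [h]; field_simp; ring
      rw [this, Finset.card_erase_of_mem (Finset.mem_univ _), Finset.card_univ]
    · simp only [not_not]
      rw [Finset.card_filter, Finset.mul_sum]
      refine Finset.sum_congr rfl fun j hj => ?_
      have hj' : c j = 0 := (Finset.mem_filter.1 hj).2
      by_cases hw : w j = 0 <;> simp [hj', hw]
  have hle : Fintype.card F * weightOn J c ≤ ∑ a : F, weightOn J (w + a • c) := by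
    rw [← Finset.card_univ, ← smul_eq_mul]
    exact Finset.card_nsmul_le_sum _ _ _ fun a _ => hmin a
  obtain ⟨p, hp⟩ : ∃ p, Fintype.card F = p + 1 :=
    Nat.exists_eq_succ_of_ne_zero Fintype.card_ne_zero
  rw [key, hp] at hle
  rw [hp]
  simp only [Nat.add_sub_cancel] at hle
  nlinarith

/-- The **Griesmer bound**: if every nonzero word of a code of dimension at least `k` has more
than `e` nonzero coordinates in `J`, then `∑ i < k, ⌈(e + 1) / q ^ i⌉ ≤ #J`. -/
theorem griesmer_bound {ι F : Type*} [Fintype ι] [Field F] [Fintype F] [DecidableEq F]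
    (k : ℕ) : ∀ (e : ℕ) (J : Finset ι) (V : Submodule F (ι → F)),
      k ≤ Module.finrank F V → (∀ v ∈ V, v ≠ 0 → e < weightOn J v) →
      ∑ i ∈ Finset.range k, (e / Fintype.card F ^ i + 1) ≤ J.card := by
  classical
  induction k with
  | zero => intros; simp
  | succ k ih =>
    intro e J V hV hw
    have hne : ∃ c, c ∈ V ∧ c ≠ 0 := by
      have : V ≠ ⊥ := by
        rintro rfl
        simp at hV
      exact (Submodule.ne_bot_iff V).1 this
    obtain ⟨c, ⟨hcV, hc0⟩, hcmin⟩ : ∃ c, (c ∈ V ∧ c ≠ 0) ∧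
        ∀ v, (v ∈ V ∧ v ≠ 0) → weightOn J c ≤ weightOn J v := by
      obtain ⟨c, hc, hm⟩ := Set.exists_min_image {v | v ∈ V ∧ v ≠ 0} (weightOn J)
        (Set.toFinite _) hne
      exact ⟨c, hc, fun v hv => hm v hv⟩
    have hec := hw c hcV hc0
    obtain ⟨j, hj⟩ : ∃ j, c j ≠ 0 := by
      by_contra! h
      exact hc0 (funext h)
    -- Since c j ≠ 0, this hyperplane section costs at most one dimension and contains no nonzero
    -- multiple of c. Hence w + a • c ≠ 0 for every nonzero w in W, and minimality of c applies to
    -- it.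
    let W : Submodule F (ι → F) := V ⊓ LinearMap.ker (LinearMap.proj j : (ι → F) →ₗ[F] F)
    have hW : k ≤ Module.finrank F W := by
      have h1 := Submodule.finrank_sup_add_finrank_inf_eq V
        (LinearMap.ker (LinearMap.proj j : (ι → F) →ₗ[F] F))
      have h2 := LinearMap.finrank_range_add_finrank_ker
        (LinearMap.proj j : (ι → F) →ₗ[F] F)
      have h3 : Module.finrank F (LinearMap.range (LinearMap.proj j : (ι → F) →ₗ[F] F)) ≤ 1 := by
        simpa using Submodule.finrank_le (LinearMap.range (LinearMap.proj j : (ι → F) →ₗ[F] F))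
      have h4 := Submodule.finrank_le
        (V ⊔ LinearMap.ker (LinearMap.proj j : (ι → F) →ₗ[F] F))
      change k ≤ Module.finrank F
        (V ⊓ LinearMap.ker (LinearMap.proj j : (ι → F) →ₗ[F] F) : Submodule F (ι → F))
      omega
    have hres := ih (e / Fintype.card F) (J.filter fun j => c j = 0) W hW (by
      intro w hwW hw0
      refine Nat.div_lt_of_lt_mul (hec.trans_le
        (weightOn_le_card_mul_weightOn_residual J c w fun a => hcmin _ ⟨?_, ?_⟩))
      · exact V.add_mem hwW.1 (V.smul_mem _ hcV)
      · intro h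
        have hwj : w j = 0 := hwW.2
        have h' := congrFun h j
        simp only [Pi.add_apply, Pi.smul_apply, hwj, smul_eq_mul, zero_add, Pi.zero_apply,
          mul_eq_zero, hj, or_false] at h'
        rw [h', zero_smul, add_zero] at h
        exact hw0 h)
    rw [Finset.sum_range_succ']
    simp only [Nat.div_div_eq_div_mul, ← pow_succ'] at hres
    have hcard := Finset.card_filter_add_card_filter_not (s := J) (fun j => c j = 0)
    unfold weightOn at hec
    simp only [pow_zero, Nat.div_one]
    change _ + (J.filter fun j => c j ≠ 0).card = _ at hcard
    omega

/-! ### Coordinate subspaces as disjoint blocks -/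

theorem mem_coordSubspace_iff {F : Type*} [Field F] {k : ℕ} (S : Finset (Fin k))
    (v : Fin k → F) : v ∈ coordSubspace F S ↔ ∀ j, j ∉ S → v j = 0 := by
  constructor
  · intro hv j hj
    have hle : coordSubspace F S ≤ LinearMap.ker (LinearMap.proj j : (Fin k → F) →ₗ[F] F) := by
      refine Submodule.span_le.2 ?_
      rintro _ ⟨i, hi, rfl⟩
      have : j ≠ i := fun h => hj (h ▸ hi)
      simp [this]
    exact hle hv
  · intro hv
    have : v = ∑ j ∈ S, v j • (Pi.single j 1 : Fin k → F) := by
      ext i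
      by_cases hi : i ∈ S <;> simp [Finset.sum_apply, Pi.single_apply, hi, hv]
    rw [this]
    exact Submodule.sum_mem _ fun j hj =>
      Submodule.smul_mem _ _ (Submodule.subset_span ⟨j, hj, rfl⟩)

/-- The inclusion of the `i`-th coordinate block. -/
noncomputable def blockIncl (F : Type*) [Field F] {k u h : ℕ} (f : Fin h × Fin u → Fin k)
    (i : Fin h) : (Fin u → F) →ₗ[F] (Fin k → F) :=
  Function.ExtendByZero.linearMap F fun a => f (i, a)

/-- The restriction of a vector to the `i`-th coordinate block. -/
def blockRestrict (F : Type*) [Field F] {k u h : ℕ} (f : Fin h × Fin u → Fin k)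
    (i : Fin h) : (Fin k → F) →ₗ[F] (Fin u → F) :=
  LinearMap.funLeft F F fun a => f (i, a)

/-- The number of blocks on which a vector is nonzero. -/
def blockWeight {F : Type*} [Field F] [DecidableEq F] {k u h : ℕ} (f : Fin h × Fin u → Fin k)
    (x : Fin k → F) : ℕ :=
  (Finset.univ.filter fun i => blockRestrict F f i x ≠ 0).card

theorem blockRestrict_apply {F : Type*} [Field F] {k u h : ℕ} (f : Fin h × Fin u → Fin k)
    (i : Fin h) (x : Fin k → F) (a : Fin u) : blockRestrict F f i x a = x (f (i, a)) := rfl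

theorem block_injective {k u h : ℕ} {f : Fin h × Fin u → Fin k} (hf : Function.Injective f)
    (i : Fin h) : Function.Injective fun a => f (i, a) := fun a b hab => by
  simpa using hf hab

theorem blockIncl_injective {F : Type*} [Field F] {k u h : ℕ} {f : Fin h × Fin u → Fin k}
    (hf : Function.Injective f) (i : Fin h) : Function.Injective (blockIncl F f i) :=
  Function.extend_injective (block_injective hf i) _

theorem blockIncl_apply {F : Type*} [Field F] {k u h : ℕ} {f : Fin h × Fin u → Fin k}
    (hf : Function.Injective f) (i : Fin h) (y : Fin u → F) (a : Fin u) :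
    blockIncl F f i y (f (i, a)) = y a :=
  (block_injective hf i).extend_apply y 0 a

theorem blockIncl_apply_of_forall_ne {F : Type*} [Field F] {k u h : ℕ}
    {f : Fin h × Fin u → Fin k} (i : Fin h) (y : Fin u → F) {j : Fin k}
    (hj : ∀ a, f (i, a) ≠ j) : blockIncl F f i y j = 0 :=
  Function.extend_apply' _ _ _ (by rintro ⟨a, ha⟩; exact hj a ha)

/-- Restriction is adjoint to inclusion; thus x · v vanishes identically on a block exactly when x
restricts to zero there. -/
theorem dotProduct_blockIncl {F : Type*} [Field F] {k u h : ℕ} {f : Fin h × Fin u → Fin k}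
    (hf : Function.Injective f) (i : Fin h) (x : Fin k → F) (y : Fin u → F) :
    x ⬝ᵥ blockIncl F f i y = blockRestrict F f i x ⬝ᵥ y := by
  classical
  unfold dotProduct
  rw [← Finset.sum_subset (Finset.subset_univ (Finset.univ.image fun a => f (i, a))),
    Finset.sum_image fun a _ b _ hab => block_injective hf i hab]
  · exact Finset.sum_congr rfl fun a _ => by rw [blockIncl_apply hf, blockRestrict_apply]
  · intro j _ hj
    rw [blockIncl_apply_of_forall_ne, mul_zero]
    intro a ha
    exact hj (Finset.mem_image.2 ⟨a, Finset.mem_univ _, ha⟩)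

theorem range_blockIncl {F : Type*} [Field F] {k u h : ℕ} {f : Fin h × Fin u → Fin k}
    (hf : Function.Injective f) (i : Fin h) (S : Finset (Fin k))
    (hS : ∀ j, j ∈ S ↔ ∃ a, f (i, a) = j) :
    LinearMap.range (blockIncl F f i) = coordSubspace F S := by
  ext v
  rw [mem_coordSubspace_iff, LinearMap.mem_range]
  constructor
  · rintro ⟨y, rfl⟩ j hj
    exact blockIncl_apply_of_forall_ne i y fun a ha => hj ((hS j).2 ⟨a, ha⟩)
  · intro hv
    refine ⟨blockRestrict F f i v, ?_⟩
    ext j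
    by_cases hj : ∃ a, f (i, a) = j
    · obtain ⟨a, rfl⟩ := hj
      rw [blockIncl_apply hf, blockRestrict_apply]
    · rw [blockIncl_apply_of_forall_ne i _ fun a ha => hj ⟨a, ha⟩,
        hv j fun hjS => hj ((hS j).1 hjS)]

theorem range_blockIncl_inf_eq_bot {F : Type*} [Field F] {k u h : ℕ}
    {f : Fin h × Fin u → Fin k} (hf : Function.Injective f) {i i' : Fin h} (hi : i ≠ i') :
    LinearMap.range (blockIncl F f i) ⊓ LinearMap.range (blockIncl F f i') = ⊥ := by
  rw [eq_bot_iff]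
  rintro v ⟨⟨y, hy⟩, ⟨z, hz⟩⟩
  rw [Submodule.mem_bot]
  ext j
  by_cases hj : ∃ a, f (i, a) = j
  · obtain ⟨a, rfl⟩ := hj
    rw [← hz, blockIncl_apply_of_forall_ne, Pi.zero_apply]
    intro b hb
    exact hi (congrArg Prod.fst (hf hb)).symm
  · rw [← hy, blockIncl_apply_of_forall_ne i _ fun a ha => hj ⟨a, ha⟩, Pi.zero_apply]

theorem isCoordFamily_range_blockIncl {F : Type*} [Field F] {k u h : ℕ}
    {f : Fin h × Fin u → Fin k} (hf : Function.Injective f) :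
    IsCoordFamily u fun i => LinearMap.range (blockIncl F f i) := by
  classical
  refine ⟨fun i => ⟨Finset.univ.image fun a => f (i, a), ?_, ?_⟩, fun i j hij =>
    range_blockIncl_inf_eq_bot hf hij⟩
  · rw [Finset.card_image_of_injective _ (block_injective hf i), Finset.card_univ,
      Fintype.card_fin]
  · exact range_blockIncl hf i _ (by simp)

/-- An index common to two of the sets would put its basis vector in both subspaces. The index sets
are therefore disjoint, and one injection `f` enumerates them all. -/
theorem IsCoordFamily.exists_eq_range_blockIncl {F : Type*} [Field F] {k u h : ℕ}
    {U : Fin h → Submodule F (Fin k → F)} (hU : IsCoordFamily u U) :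
    ∃ f : Fin h × Fin u → Fin k, Function.Injective f ∧
      U = fun i => LinearMap.range (blockIncl F f i) := by
  obtain ⟨hS, hdisj⟩ := hU
  choose S hcard hUS using hS
  have hrange : ∀ i j, j ∈ S i ↔ ∃ a, (S i).orderEmbOfFin (hcard i) a = j := by
    intro i j
    have := Finset.range_orderEmbOfFin (S i) (hcard i)
    rw [← Finset.mem_coe, ← this]
    rfl
  have hf : Function.Injective
      fun p : Fin h × Fin u => (S p.1).orderEmbOfFin (hcard p.1) p.2 := by
    rintro ⟨i, a⟩ ⟨i', a'⟩ hp
    have hii : i = i' := by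
      by_contra hne
      have h1 := (hrange i _).2 ⟨a, rfl⟩
      have h2 := (hrange i' _).2 ⟨a', hp.symm⟩
      have hmem : (Pi.single ((S i).orderEmbOfFin (hcard i) a) 1 : Fin k → F) ∈ U i ⊓ U i' := by
        rw [hUS i, hUS i']
        exact ⟨Submodule.subset_span ⟨_, h1, rfl⟩, Submodule.subset_span ⟨_, h2, rfl⟩⟩
      rw [hdisj i i' hne, Submodule.mem_bot, Pi.single_eq_zero_iff] at hmem
      exact one_ne_zero hmem
    subst hii
    simpa using hp
  exact ⟨_, hf, funext fun i => (hUS i).trans (range_blockIncl hf i _ (hrange i)).symm⟩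

theorem exists_isCoordFamily (F : Type*) [Field F] {k u h : ℕ} (hk : h * u ≤ k) :
    ∃ U : Fin h → Submodule F (Fin k → F), IsCoordFamily u U :=
  ⟨_, isCoordFamily_range_blockIncl (F := F) (f := fun p => Fin.castLE hk (finProdFinEquiv p))
    ((Fin.castLE_injective hk).comp finProdFinEquiv.injective)⟩

/-! ### Counting vectors and columns -/

/-- Vectors outside the blocks satisfying `P` are counted by inclusion-exclusion. -/
theorem ncard_outsideVectors_add {F : Type*} [Field F] [Fintype F] [DecidableEq F] {k u h : ℕ}
    {f : Fin h × Fin u → Fin k} (hf : Function.Injective f) (P : (Fin k → F) → Prop)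
    [DecidablePred P] (hP : ¬ P 0) :
    {v | v ∈ outsideVectors (fun i => LinearMap.range (blockIncl F f i)) ∧ P v}.ncard +
      ∑ i, (Finset.univ.filter fun y : Fin u → F => P (blockIncl F f i y)).card =
    (Finset.univ.filter P).card := by
  classical
  have hB : ∀ i, (Finset.univ.filter fun y : Fin u → F => P (blockIncl F f i y)).card =
      (Finset.univ.filter fun v => v ∈ LinearMap.range (blockIncl F f i) ∧ P v).card := by
    intro i
    rw [← Finset.card_image_of_injective _ (blockIncl_injective (F := F) hf i)]
    congr 1
    ext v
    simp only [Finset.mem_image, Finset.mem_filter, Finset.mem_univ, true_and,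
      LinearMap.mem_range]
    constructor
    · rintro ⟨y, hy, rfl⟩; exact ⟨⟨y, rfl⟩, hy⟩
    · rintro ⟨⟨y, rfl⟩, hy⟩; exact ⟨y, hy, rfl⟩
  simp only [hB]
  -- Two blocks share only 0, where `P` fails, so no higher inclusion-exclusion terms occur.
  rw [← Finset.card_biUnion]
  · rw [Set.ncard_eq_toFinset_card', ← Finset.card_union_of_disjoint]
    · congr 1
      ext v
      rw [Finset.mem_union, Set.mem_toFinset]
      simp only [outsideVectors, Set.mem_ofPred_eq,
        Finset.mem_biUnion, Finset.mem_filter, Finset.mem_univ, true_and]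
      have : P v → v ≠ 0 := by rintro h rfl; exact hP h
      by_cases hv : ∃ i, v ∈ LinearMap.range (blockIncl F f i)
      · obtain ⟨i, hi⟩ := hv
        exact ⟨by tauto, fun hp => Or.inr ⟨i, hi, hp⟩⟩
      · push Not at hv
        exact ⟨by rintro (⟨-, hp⟩ | ⟨i, -, hp⟩) <;> exact hp,
          fun hp => Or.inl ⟨⟨this hp, hv⟩, hp⟩⟩
    · rw [Finset.disjoint_left]
      intro v hv hv'
      rw [Set.mem_toFinset] at hv
      simp only [outsideVectors, Set.mem_ofPred_eq, Finset.mem_biUnion,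
        Finset.mem_filter, Finset.mem_univ, true_and] at hv hv'
      obtain ⟨i, hi, -⟩ := hv'
      exact hv.1.2 i hi
  · intro i _ j _ hij
    rw [Function.onFun, Finset.disjoint_left]
    intro v hv hv'
    simp only [Finset.mem_filter, Finset.mem_univ, true_and] at hv hv'
    have : v ∈ LinearMap.range (blockIncl F f i) ⊓ LinearMap.range (blockIncl F f j) :=
      ⟨hv.1, hv'.1⟩
    rw [range_blockIncl_inf_eq_bot hf hij, Submodule.mem_bot] at this
    exact hP (this ▸ hv.2)

/-- Each column of `G` accounts for `q - 1` vectors of `T`. -/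
theorem PicksOneFromEachClass.ncard_eq {F : Type*} [Field F] [Fintype F] [DecidableEq F]
    {k n : ℕ} {G : Matrix (Fin k) (Fin n) F} {T : Set (Fin k → F)}
    (hG : PicksOneFromEachClass G T) (hT : ∀ v ∈ T, ∀ c : F, c ≠ 0 → c • v ∈ T)
    (hT0 : (0 : Fin k → F) ∉ T) (P : (Fin k → F) → Prop) [DecidablePred P]
    (hP : ∀ v, ∀ c : F, c ≠ 0 → (P (c • v) ↔ P v)) :
    {v | v ∈ T ∧ P v}.ncard =
      (Fintype.card F - 1) * (Finset.univ.filter fun j => P fun i => G i j).card := by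
  classical
  rw [← Finset.card_univ, ← Finset.card_erase_of_mem (Finset.mem_univ (0 : F)),
    ← Finset.card_product, Set.ncard_eq_toFinset_card']
  symm
  refine Finset.card_bij (fun p _ => p.1 • fun i => G i p.2) ?_ ?_ ?_
  · rintro ⟨c, j⟩ hp
    simp only [Finset.mem_product, Finset.mem_erase, Finset.mem_univ, and_true,
      Finset.mem_filter, true_and] at hp
    simp only [Set.mem_toFinset, Set.mem_ofPred_eq]
    exact ⟨hT _ (hG.1 j) c hp.1, (hP _ c hp.1).2 hp.2⟩
  · rintro ⟨c, j⟩ hp ⟨c', j'⟩ hp' heq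
    simp only [Finset.mem_product, Finset.mem_erase, Finset.mem_univ, and_true,
      Finset.mem_filter, true_and] at hp hp' heq
    have hj : j = j' := (hG.2 _ (hT _ (hG.1 j) c hp.1)).unique ⟨c, hp.1, rfl⟩ ⟨c', hp'.1, heq⟩
    subst hj
    have hne : (fun i => G i j) ≠ 0 := fun h => hT0 (h ▸ hG.1 j)
    rw [smul_left_injective F hne heq]
  · intro v hv
    simp only [Set.mem_toFinset, Set.mem_ofPred_eq] at hv
    obtain ⟨j, ⟨c, hc, rfl⟩, -⟩ := hG.2 v hv.1
    refine ⟨(c, j), ?_, rfl⟩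
    simp only [Finset.mem_product, Finset.mem_erase, Finset.mem_univ, and_true,
      Finset.mem_filter, true_and]
    exact ⟨hc, (hP _ c hc).1 hv.2⟩

theorem smul_mem_outsideVectors {F : Type*} [Field F] {k h : ℕ}
    {U : Fin h → Submodule F (Fin k → F)} {v : Fin k → F} (hv : v ∈ outsideVectors U) {c : F}
    (hc : c ≠ 0) : c • v ∈ outsideVectors U :=
  ⟨smul_ne_zero hc hv.1, fun i hi => hv.2 i (((U i).smul_mem_iff hc).1 hi)⟩

/-- The classes are points of projective space, and `rep` selects a vector in each. As the outside
set is stable under nonzero scalars, membership of `rep` depends only on the point. -/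
theorem exists_picksOneFromEachClass {F : Type*} [Field F] [Fintype F] {k h : ℕ}
    (U : Fin h → Submodule F (Fin k → F)) :
    ∃ (n : ℕ) (G : Matrix (Fin k) (Fin n) F), PicksOneFromEachClass G (outsideVectors U) := by
  classical
  let s : Set (Projectivization F (Fin k → F)) := {p | p.rep ∈ outsideVectors U}
  have : Finite (Projectivization F (Fin k → F)) := Quotient.finite _
  let e := Finite.equivFin s
  refine ⟨_, fun i j => (e.symm j).1.rep i, fun j => (e.symm j).2, fun v hv => ?_⟩
  have hrep : ∀ p : Projectivization F (Fin k → F),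
      (∃ c : F, c ≠ 0 ∧ v = c • p.rep) ↔ p = Projectivization.mk F v hv.1 := by
    intro p
    constructor
    · rintro ⟨c, hc, h⟩
      rw [← p.mk_rep]
      refine ((Projectivization.mk_eq_mk_iff' F _ _ _ _).2 ⟨c⁻¹, ?_⟩)
      rw [h, smul_smul, inv_mul_cancel₀ hc, one_smul]
    · rintro rfl
      obtain ⟨a, ha⟩ := Projectivization.exists_smul_eq_mk_rep F v hv.1
      refine ⟨((a⁻¹ : Fˣ) : F), (a⁻¹).ne_zero, ?_⟩
      rw [← ha]
      change v = a⁻¹ • a • v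
      rw [inv_smul_smul]
  have hmem : Projectivization.mk F v hv.1 ∈ s := by
    obtain ⟨a, ha⟩ := Projectivization.exists_smul_eq_mk_rep F v hv.1
    change (Projectivization.mk F v hv.1).rep ∈ outsideVectors U
    rw [← ha]
    exact smul_mem_outsideVectors hv a.ne_zero
  refine ⟨e ⟨_, hmem⟩, ?_, ?_⟩
  · exact (hrep _).2 (congrArg Subtype.val (e.symm_apply_apply _))
  · intro j hj
    have := (hrep (e.symm j).1).1 hj
    rw [← e.symm_apply_eq]
    exact Subtype.ext this

/-! ### Length and weights of the code -/

theorem card_mul_card_dotProduct_ne_zero {ι F : Type*} [Fintype ι] [DecidableEq ι] [Field F]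
    [Fintype F] [DecidableEq F] (x : ι → F) :
    Fintype.card F * (Finset.univ.filter fun y => x ⬝ᵥ y ≠ 0).card =
      if x ≠ 0 then (Fintype.card F - 1) * Fintype.card F ^ Fintype.card ι else 0 := by
  split_ifs with hx
  · rw [← Fintype.card_fun]
    refine card_mul_card_functional_ne_zero (dotProductBilin F F x) fun h => hx ?_
    refine dotProduct_eq_zero x fun w => ?_
    exact LinearMap.congr_fun h w
  · rw [not_not] at hx
    simp [hx]

theorem blockWeight_le {F : Type*} [Field F] [DecidableEq F] {k u h : ℕ}
    {f : Fin h × Fin u → Fin k} (x : Fin k → F) : blockWeight f x ≤ h :=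
  (Finset.card_filter_le _ _).trans (by simp)

section

variable {F : Type*} [Field F] [Fintype F] [DecidableEq F] {k u h n : ℕ}
  {f : Fin h × Fin u → Fin k} {G : Matrix (Fin k) (Fin n) F}

theorem length_mul_add (hf : Function.Injective f)
    (hG : PicksOneFromEachClass G (outsideVectors fun i => LinearMap.range (blockIncl F f i))) :
    (Fintype.card F - 1) * n + h * (Fintype.card F ^ u - 1) = Fintype.card F ^ k - 1 := by
  have h1 := hG.ncard_eq (fun v hv c hc => smul_mem_outsideVectors hv hc) (fun h => h.1 rfl)
    (fun v => v ≠ 0) (fun v c hc => by simp [hc])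
  have h2 := ncard_outsideVectors_add (F := F) hf (fun v => v ≠ 0) (by simp)
  have h3 : ∀ j : Fin n, (fun i => G i j) ≠ 0 := fun j => (hG.1 j).1
  have h4 : ∀ (i : Fin h) (y : Fin u → F), blockIncl F f i y ≠ 0 ↔ y ≠ 0 := fun i y =>
    (map_ne_zero_iff _ (blockIncl_injective hf i))
  rw [h1] at h2
  simpa [h3, h4, Finset.filter_ne', Finset.card_erase_of_mem] using h2

/-- Apply both counts to the predicate x · v ≠ 0. The additive form avoids truncated subtraction. -/
theorem hammingNorm_vecMul_add (hf : Function.Injective f) (hu : 1 ≤ u) (hk : 1 ≤ k)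
    (hG : PicksOneFromEachClass G (outsideVectors fun i => LinearMap.range (blockIncl F f i)))
    {x : Fin k → F} (hx : x ≠ 0) :
    hammingNorm (Matrix.vecMul x G) + Fintype.card F ^ (u - 1) * blockWeight f x =
      Fintype.card F ^ (k - 1) := by
  have h1 := hG.ncard_eq (fun v hv c hc => smul_mem_outsideVectors hv hc) (fun h => h.1 rfl)
    (fun v => x ⬝ᵥ v ≠ 0) (fun v c hc => by simp [hc])
  have h2 := ncard_outsideVectors_add (F := F) hf (fun v => x ⬝ᵥ v ≠ 0) (by simp)
  have h3 : (Finset.univ.filter fun j => x ⬝ᵥ (fun i => G i j) ≠ 0).card =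
      hammingNorm (Matrix.vecMul x G) := rfl
  rw [h1, h3] at h2
  simp only [dotProduct_blockIncl hf] at h2
  have h4 := congrArg (Fintype.card F * ·) h2
  simp only [mul_add, Finset.mul_sum, card_mul_card_dotProduct_ne_zero, if_pos hx] at h4
  rw [← Finset.sum_filter, Finset.sum_const, smul_eq_mul, Fintype.card_fin,
    Fintype.card_fin] at h4
  change _ + blockWeight f x * _ = _ at h4
  obtain ⟨u, rfl⟩ := Nat.exists_eq_add_of_le' hu
  obtain ⟨k, rfl⟩ := Nat.exists_eq_add_of_le' hk
  have hq : 1 < Fintype.card F := Fintype.one_lt_card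
  have hpos : 0 < Fintype.card F * (Fintype.card F - 1) :=
    Nat.mul_pos (by omega) (by omega)
  refine Nat.eq_of_mul_eq_mul_left hpos ?_
  simp only [Nat.add_sub_cancel]
  calc _ = Fintype.card F * ((Fintype.card F - 1) * hammingNorm (Matrix.vecMul x G)) +
      blockWeight f x * ((Fintype.card F - 1) * Fintype.card F ^ (u + 1)) := by ring
    _ = _ := by rw [h4]; ring

/-- F^k splits into h blocks and k - hu free coordinates. A block in `A` has q^u - 1 choices, any
other block one. -/
theorem card_eq_blockPattern (hf : Function.Injective f) (A : Finset (Fin h)) :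
    (Finset.univ.filter fun x : Fin k → F =>
      (Finset.univ.filter fun i => blockRestrict F f i x ≠ 0) = A).card =
      (Fintype.card F ^ u - 1) ^ A.card * Fintype.card F ^ (k - h * u) := by
  classical
  let e : (Fin h × Fin u) ⊕ ↥((Set.range f)ᶜ) ≃ Fin k :=
    ((Equiv.ofInjective f hf).sumCongr (Equiv.refl _)).trans (Equiv.Set.sumCompl _)
  let E : (Fin k → F) ≃ (Fin h → Fin u → F) × (↥((Set.range f)ᶜ) → F) :=
    ((e.symm.arrowCongr (Equiv.refl F)).trans (Equiv.sumArrowEquivProdArrow _ _ _)).trans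
      ((Equiv.curry _ _ _).prodCongr (Equiv.refl _))
  have hE : ∀ x i, (E x).1 i = blockRestrict F f i x := by
    intro x i
    rfl
  have hcard : Fintype.card ↥((Set.range f)ᶜ) = k - h * u := by
    have := Fintype.card_congr e
    simp only [Fintype.card_sum, Fintype.card_prod, Fintype.card_fin] at this
    omega
  rw [Finset.card_equiv E (t := (Fintype.piFinset fun i =>
    if i ∈ A then Finset.univ.erase (0 : Fin u → F) else {0}) ×ˢ Finset.univ)]
  · rw [Finset.card_product, Fintype.card_piFinset, Finset.card_univ, Fintype.card_fun, hcard]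
    congr 1
    simp only [apply_ite Finset.card, Finset.card_erase_of_mem (Finset.mem_univ _),
      Finset.card_univ, Fintype.card_fun, Fintype.card_fin, Finset.card_singleton]
    rw [Finset.prod_ite_mem, Finset.univ_inter, Finset.prod_const]
  · intro x
    simp only [Finset.mem_filter, Finset.mem_univ, true_and, Finset.mem_product,
      Fintype.mem_piFinset, and_true, hE, Finset.ext_iff]
    refine forall_congr' fun i => ?_
    by_cases hi : i ∈ A <;> simp [hi]

theorem card_blockWeight_eq (hf : Function.Injective f) (m : ℕ) :
    (Finset.univ.filter fun x : Fin k → F => blockWeight f x = m).card =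
      h.choose m * (Fintype.card F ^ u - 1) ^ m * Fintype.card F ^ (k - h * u) := by
  classical
  rw [Finset.card_eq_sum_card_fiberwise (f := fun x : Fin k → F =>
    Finset.univ.filter fun i => blockRestrict F f i x ≠ 0)
    (t := Finset.powersetCard m (Finset.univ : Finset (Fin h)))]
  · rw [Finset.sum_congr rfl (g := fun _ => (Fintype.card F ^ u - 1) ^ m *
      Fintype.card F ^ (k - h * u)), Finset.sum_const, Finset.card_powersetCard,
      Finset.card_univ, Fintype.card_fin, smul_eq_mul, mul_assoc]
    intro A hA
    rw [← (Finset.mem_powersetCard.1 hA).2, ← card_eq_blockPattern hf A]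
    congr 1
    ext x
    simp only [Finset.filter_filter, Finset.mem_filter, Finset.mem_univ, true_and,
      and_iff_right_iff_imp]
    rintro rfl
    rfl
  · intro x hx
    simp only [Finset.coe_filter, Finset.mem_univ, true_and, Set.mem_ofPred_eq] at hx
    rw [Finset.mem_coe, Finset.mem_powersetCard]
    exact ⟨Finset.subset_univ _, hx⟩

/-- A nonzero kernel vector would need q^(u-1) b(x) = q^(k-1), impossible as b(x) ≤ h. -/
theorem vecMulLinear_injective (hf : Function.Injective f) (hu : 1 ≤ u) (hk : 1 ≤ k)
    (hG : PicksOneFromEachClass G (outsideVectors fun i => LinearMap.range (blockIncl F f i)))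
    (hlt : h * Fintype.card F ^ (u - 1) < Fintype.card F ^ (k - 1)) :
    Function.Injective (Matrix.vecMulLinear G) := by
  rw [← LinearMap.ker_eq_bot, LinearMap.ker_eq_bot']
  intro x hx
  by_contra hne
  have h1 := hammingNorm_vecMul_add hf hu hk hG hne
  rw [Matrix.vecMulLinear_apply] at hx
  rw [hx, hammingNorm_zero, zero_add, mul_comm] at h1
  have := Nat.mul_le_mul_right (Fintype.card F ^ (u - 1)) (blockWeight_le (f := f) x)
  omega

theorem weightMultiplicity_codeOfMatrix (hinj : Function.Injective (Matrix.vecMulLinear G))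
    (w : ℕ) : weightMultiplicity (codeOfMatrix G) w =
      (Finset.univ.filter fun x : Fin k → F => hammingNorm (Matrix.vecMul x G) = w).card := by
  classical
  rw [← Finset.card_image_of_injective _ hinj, ← Set.ncard_coe_finset]
  unfold weightMultiplicity codeOfMatrix
  congr 1
  ext c
  simp only [Set.mem_ofPred_eq, LinearMap.mem_range, Finset.coe_image, Finset.coe_filter,
    Finset.mem_univ, true_and, Set.mem_image, Matrix.vecMulLinear_apply]
  constructor
  · rintro ⟨⟨x, rfl⟩, hx⟩; exact ⟨x, hx, rfl⟩
  · rintro ⟨x, hx, rfl⟩; exact ⟨⟨x, rfl⟩, hx⟩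

end

/-! ### Generalized Hamming weights -/

theorem Submodule.exists_le_finrank_eq {K V : Type*} [DivisionRing K] [AddCommGroup V]
    [Module K V] [FiniteDimensional K V] (W : Submodule K V) {r : ℕ}
    (hWr : Module.finrank K W ≤ r) (hr : r ≤ Module.finrank K V) :
    ∃ X : Submodule K V, W ≤ X ∧ Module.finrank K X = r := by
  induction r, hWr using Nat.le_induction with
  | base => exact ⟨W, le_rfl, rfl⟩
  | succ r _ ih =>
    obtain ⟨X, hWX, hX⟩ := ih (by omega)
    obtain ⟨v, hv⟩ : ∃ v, v ∉ X := by
      by_contra! h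
      rw [(Submodule.eq_top_iff' (p := X)).2 h, finrank_top] at hX
      omega
    refine ⟨X ⊔ Submodule.span K {v}, hWX.trans le_sup_left, le_antisymm ?_ ?_⟩
    · refine (Submodule.finrank_add_le_finrank_add_finrank _ _).trans ?_
      rw [hX]
      exact Nat.add_le_add_left (by simpa using finrank_span_le_card ({v} : Set V)) r
    · rw [← hX]
      refine Submodule.finrank_lt_finrank_of_lt (lt_of_le_of_ne le_sup_left fun h => hv ?_)
      rw [h]
      exact Submodule.mem_sup_right (Submodule.mem_span_singleton_self v)

theorem finrank_map_eq_of_injective {K V V' : Type*} [DivisionRing K] [AddCommGroup V]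
    [Module K V] [AddCommGroup V'] [Module K V'] {g : V →ₗ[K] V'} (hg : Function.Injective g)
    (X : Submodule K V) : Module.finrank K (X.map g) = Module.finrank K X :=
  (Submodule.equivMapOfInjective g hg X).finrank_eq.symm

theorem finrank_sub_le_finrank_ker_blockRestrict {F : Type*} [Field F] {k u h : ℕ}
    {f : Fin h × Fin u → Fin k} (X : Submodule F (Fin k → F)) (i : Fin h) :
    Module.finrank F X - u ≤
      Module.finrank F (LinearMap.ker ((blockRestrict F f i).domRestrict X)) := by
  have h1 := LinearMap.finrank_range_add_finrank_ker ((blockRestrict F f i).domRestrict X)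
  have h2 := Submodule.finrank_le (LinearMap.range ((blockRestrict F f i).domRestrict X))
  rw [Module.finrank_fin_fun] at h2
  omega

/-- There is a subspace of each dimension in general position to all the blocks. -/
theorem exists_finrank_ker_blockRestrict_eq {F : Type*} [Field F] {k u h : ℕ}
    {f : Fin h × Fin u → Fin k} (hf : Function.Injective f) (hh : 0 < h) {r : ℕ}
    (hr : r ≤ k) : ∃ X : Submodule F (Fin k → F), Module.finrank F X = r ∧
      ∀ i, Module.finrank F (LinearMap.ker ((blockRestrict F f i).domRestrict X)) = r - u := by
  -- The diagonal map repeats y in every block. Subspaces inside its range restrict injectively to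
  -- each block (r ≤ u); subspaces containing it restrict surjectively (u ≤ r).
  let Φ : (Fin u → F) →ₗ[F] (Fin k → F) :=
    Function.ExtendByZero.linearMap F f ∘ₗ LinearMap.funLeft F F Prod.snd
  have hΦ : ∀ i y, blockRestrict F f i (Φ y) = y := by
    intro i y
    ext a
    exact hf.extend_apply _ _ _
  have hΦi : Function.Injective Φ := fun y z hyz => by
    rw [← hΦ ⟨0, hh⟩ y, hyz, hΦ]
  rcases le_total r u with hru | hur
  · obtain ⟨Y, -, hY⟩ := Submodule.exists_le_finrank_eq (⊥ : Submodule F (Fin u → F))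
      (r := r) (by simp) (by simpa using hru)
    refine ⟨Y.map Φ, by rw [finrank_map_eq_of_injective hΦi, hY], fun i => ?_⟩
    rw [Nat.sub_eq_zero_of_le hru, Submodule.finrank_eq_zero, LinearMap.ker_eq_bot']
    rintro ⟨_, y, hy, rfl⟩ h0
    change blockRestrict F f i (Φ y) = 0 at h0
    rw [hΦ] at h0
    ext1
    change Φ y = 0
    rw [h0, map_zero]
  · obtain ⟨X, hle, hX⟩ := Submodule.exists_le_finrank_eq (LinearMap.range Φ) (r := r)
      (by rwa [LinearMap.finrank_range_of_inj hΦi, Module.finrank_fin_fun]) (by simpa using hr)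
    refine ⟨X, hX, fun i => ?_⟩
    have h1 := LinearMap.finrank_range_add_finrank_ker ((blockRestrict F f i).domRestrict X)
    have h2 : LinearMap.range ((blockRestrict F f i).domRestrict X) = ⊤ :=
      LinearMap.range_eq_top.2 fun y => ⟨⟨Φ y, hle ⟨y, rfl⟩⟩, hΦ i y⟩
    rw [h2, finrank_top, Module.finrank_fin_fun] at h1
    omega

/-- The number of coordinates at which some word encoded by `X` is nonzero. -/
noncomputable def encodedSupportCard {F : Type*} [Field F] {k n : ℕ}
    (G : Matrix (Fin k) (Fin n) F) (X : Submodule F (Fin k → F)) : ℕ :=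
  (codeSupport (X.map (Matrix.vecMulLinear G))).ncard

section

variable {F : Type*} [Field F] [Fintype F] [DecidableEq F] {k u h n : ℕ}
  {f : Fin h × Fin u → Fin k} {G : Matrix (Fin k) (Fin n) F}

/-- Double counting of the nonzero coordinates of the words of a subcode. -/
theorem mul_encodedSupportCard (X : Submodule F (Fin k → F)) [Fintype X] :
    (Fintype.card F - 1) * Fintype.card X * encodedSupportCard G X =
      Fintype.card F * ∑ x : X, hammingNorm (Matrix.vecMul x.1 G) := by
  classical
  have h3 := Finset.sum_card_bipartiteAbove_eq_sum_card_bipartiteBelow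
    (s := (Finset.univ : Finset X)) (t := (Finset.univ : Finset (Fin n)))
    (fun x j => Matrix.vecMul x.1 G j ≠ 0)
  simp only [Finset.bipartiteAbove, Finset.bipartiteBelow] at h3
  unfold hammingNorm
  rw [h3, Finset.mul_sum]
  have h4 : ∀ j : Fin n, Fintype.card F *
      (Finset.univ.filter fun x : X => Matrix.vecMul x.1 G j ≠ 0).card =
      if j ∈ codeSupport (X.map (Matrix.vecMulLinear G)) then
        (Fintype.card F - 1) * Fintype.card X else 0 := by
    intro j
    split_ifs with hj
    · refine card_mul_card_functional_ne_zero
        (LinearMap.proj j ∘ₗ Matrix.vecMulLinear G ∘ₗ X.subtype) fun h0 => ?_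
      obtain ⟨_, ⟨x, hx, rfl⟩, hxj⟩ := hj
      exact hxj (LinearMap.congr_fun h0 ⟨x, hx⟩)
    · rw [Finset.filter_eq_empty_iff.2, Finset.card_empty, mul_zero]
      intro x _ hxj
      exact hj ⟨_, ⟨x.1, x.2, rfl⟩, hxj⟩
  simp only [h4]
  rw [← Finset.sum_filter, Finset.sum_const, smul_eq_mul, mul_comm, encodedSupportCard,
    Set.ncard_eq_toFinset_card']
  congr 2
  ext j
  simp

theorem encodedSupportCard_formula (hf : Function.Injective f) (hu : 1 ≤ u) (hk : 1 ≤ k)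
    (hG : PicksOneFromEachClass G (outsideVectors fun i => LinearMap.range (blockIncl F f i)))
    (X : Submodule F (Fin k → F)) :
    (Fintype.card F - 1) * Fintype.card F ^ Module.finrank F X * encodedSupportCard G X +
        Fintype.card F ^ u * (h * Fintype.card F ^ Module.finrank F X) + Fintype.card F ^ k =
      Fintype.card F ^ k * Fintype.card F ^ Module.finrank F X + Fintype.card F ^ u *
        ∑ i, Fintype.card F ^
          Module.finrank F (LinearMap.ker ((blockRestrict F f i).domRestrict X)) := by
  classical
  have : Fintype X := Fintype.ofFinite X
  have hX : Fintype.card X = Fintype.card F ^ Module.finrank F X := Module.card_eq_pow_finrank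
  rw [← hX, mul_encodedSupportCard]
  -- The extra q^(k-1) accounts for x = 0, which the weight formula excludes.
  have hwt : ∑ x : X, hammingNorm (Matrix.vecMul x.1 G) +
      Fintype.card F ^ (u - 1) * ∑ x : X, blockWeight f x.1 + Fintype.card F ^ (k - 1) =
      Fintype.card F ^ (k - 1) * Fintype.card X := by
    rw [Finset.mul_sum, ← Finset.sum_add_distrib,
      ← Finset.sum_erase_add _ _ (Finset.mem_univ (0 : X))]
    have h0 : hammingNorm (Matrix.vecMul (0 : X).1 G) +
        Fintype.card F ^ (u - 1) * blockWeight f (0 : X).1 = 0 := by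
      simp [blockWeight]
    rw [h0, add_zero, Finset.sum_congr rfl (g := fun _ => Fintype.card F ^ (k - 1)),
      Finset.sum_const, Finset.card_erase_of_mem (Finset.mem_univ _), Finset.card_univ,
      smul_eq_mul, ← Nat.succ_mul, mul_comm]
    · congr 1
      have : 0 < Fintype.card X := Fintype.card_pos
      omega
    · intro x hx
      refine hammingNorm_vecMul_add hf hu hk hG fun h0 => (Finset.mem_erase.1 hx).1 ?_
      exact Subtype.ext h0
  have hker : ∑ x : X, blockWeight f x.1 + ∑ i, Fintype.card F ^
      Module.finrank F (LinearMap.ker ((blockRestrict F f i).domRestrict X)) =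
      h * Fintype.card X := by
    have h3 := Finset.sum_card_bipartiteAbove_eq_sum_card_bipartiteBelow
      (s := (Finset.univ : Finset X)) (t := (Finset.univ : Finset (Fin h)))
      (fun x i => blockRestrict F f i x.1 ≠ 0)
    simp only [Finset.bipartiteAbove, Finset.bipartiteBelow] at h3
    unfold blockWeight
    rw [h3, ← Finset.sum_add_distrib, Finset.sum_congr rfl (g := fun _ => Fintype.card X),
      Finset.sum_const, Finset.card_univ, Fintype.card_fin, smul_eq_mul]
    intro i _
    rw [← Module.card_eq_pow_finrank (K := F)
      (V := LinearMap.ker ((blockRestrict F f i).domRestrict X)), Fintype.card_subtype]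
    simp only [LinearMap.mem_ker, LinearMap.domRestrict_apply]
    rw [add_comm, Finset.card_filter_add_card_filter_not, Finset.card_univ]
  obtain ⟨u, rfl⟩ := Nat.exists_eq_add_of_le' hu
  obtain ⟨k, rfl⟩ := Nat.exists_eq_add_of_le' hk
  simp only [Nat.add_sub_cancel] at hwt
  rw [← hker]
  simp only [pow_succ]
  linear_combination Fintype.card F * hwt

/-- For fixed r the support size increases with the sum of the kernel cardinalities, so the minimum
occurs where every kernel has dimension r - u. Truncated subtraction covers r ≤ u as well. -/
theorem genHammingWeight_codeOfMatrix_formula (hf : Function.Injective f) (hh : 0 < h)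
    (hu : 1 ≤ u) (hk : 1 ≤ k)
    (hG : PicksOneFromEachClass G (outsideVectors fun i => LinearMap.range (blockIncl F f i)))
    (hinj : Function.Injective (Matrix.vecMulLinear G)) {r : ℕ} (hr : r ≤ k) :
    (Fintype.card F - 1) * Fintype.card F ^ r * genHammingWeight (codeOfMatrix G) r +
        Fintype.card F ^ u * (h * Fintype.card F ^ r) + Fintype.card F ^ k =
      Fintype.card F ^ k * Fintype.card F ^ r +
        Fintype.card F ^ u * (h * Fintype.card F ^ (r - u)) := by
  obtain ⟨X, hX, hXi⟩ := exists_finrank_ker_blockRestrict_eq (F := F) hf hh hr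
  have hq : 1 < Fintype.card F := Fintype.one_lt_card
  have hXf := encodedSupportCard_formula hf hu hk hG X
  simp only [hXi, Finset.sum_const, Finset.card_univ, Fintype.card_fin, smul_eq_mul, hX] at hXf
  suffices hs : genHammingWeight (codeOfMatrix G) r = encodedSupportCard G X by rw [hs, hXf]
  refine le_antisymm (Nat.sInf_le ⟨X.map (Matrix.vecMulLinear G), LinearMap.map_le_range,
    by rw [finrank_map_eq_of_injective hinj, hX], rfl⟩) ?_
  refine le_csInf ⟨_, X.map (Matrix.vecMulLinear G), LinearMap.map_le_range,
    by rw [finrank_map_eq_of_injective hinj, hX], rfl⟩ ?_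
  rintro s ⟨D, hDC, hD, rfl⟩
  obtain ⟨Y, rfl⟩ : ∃ Y : Submodule F (Fin k → F), Y.map (Matrix.vecMulLinear G) = D :=
    ⟨D.comap _, Submodule.map_comap_eq_of_le hDC⟩
  rw [finrank_map_eq_of_injective hinj] at hD
  change _ ≤ encodedSupportCard G Y
  have hYf := encodedSupportCard_formula hf hu hk hG Y
  have hle : h * Fintype.card F ^ (r - u) ≤ ∑ i : Fin h, Fintype.card F ^
      Module.finrank F (LinearMap.ker ((blockRestrict F f i).domRestrict Y)) := by
    calc h * Fintype.card F ^ (r - u) = ∑ _i : Fin h, Fintype.card F ^ (r - u) := by simp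
      _ ≤ _ := Finset.sum_le_sum fun i _ => Nat.pow_le_pow_right (by omega)
        (hD ▸ finrank_sub_le_finrank_ker_blockRestrict Y i)
  have hle' := Nat.mul_le_mul_left (Fintype.card F ^ u) hle
  rw [hD] at hYf
  have hpos : 0 < (Fintype.card F - 1) * Fintype.card F ^ r :=
    Nat.mul_pos (by omega) (Nat.pow_pos (by omega))
  refine Nat.le_of_mul_le_mul_left ?_ hpos
  omega

end

/-! ### Arithmetic of the Griesmer sum -/

theorem pow_dvd_of_le_lowestNonzeroDigit {q h : ℕ} (hq : 2 ≤ q) :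
    ∀ {t : ℕ}, t ≤ lowestNonzeroDigit q h → q ^ t ∣ h
  | 0, _ => by simp
  | t + 1, ht => by
    have h1 := pow_dvd_of_le_lowestNonzeroDigit hq (Nat.le_of_succ_le ht)
    have h2 : (Nat.digits q h).getD t 0 = 0 := by
      by_contra hne
      exact Nat.notMem_of_lt_sInf ht hne
    rw [Nat.getD_digits _ _ hq] at h2
    rw [pow_succ]
    exact Nat.mul_dvd_of_dvd_div h1 (Nat.dvd_of_mod_eq_zero h2)

/-- Passing from h - 1 to h raises the quotient by q^t by one exactly when q^t divides h, which
holds for t ≤ i_h; `hm` keeps these t in range. -/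
theorem sum_pred_div_pow_add_lowestNonzeroDigit_le {q h m : ℕ} (hq : 2 ≤ q) (hh : 0 < h)
    (hm : h ≤ q ^ m) :
    ∑ t ∈ Finset.Icc 1 m, (h - 1) / q ^ t + lowestNonzeroDigit q h ≤
      ∑ t ∈ Finset.Icc 1 m, h / q ^ t := by
  have hi : lowestNonzeroDigit q h ≤ m :=
    (Nat.pow_le_pow_iff_right hq).1
      ((Nat.le_of_dvd hh (pow_dvd_of_le_lowestNonzeroDigit hq le_rfl)).trans hm)
  have h1 : ∀ t, h / q ^ t = (h - 1) / q ^ t + if q ^ t ∣ h then 1 else 0 := by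
    intro t
    have := Nat.succ_div (a := h - 1) (b := q ^ t)
    rwa [Nat.sub_add_cancel hh] at this
  rw [Finset.sum_congr rfl fun t _ => h1 t, Finset.sum_add_distrib, ← Finset.card_filter]
  refine Nat.add_le_add_left ?_ _
  calc lowestNonzeroDigit q h = (Finset.Icc 1 (lowestNonzeroDigit q h)).card := by simp
    _ ≤ _ := Finset.card_le_card fun t ht => by
      rw [Finset.mem_Icc] at ht
      exact Finset.mem_filter.2 ⟨Finset.mem_Icc.2 ⟨ht.1, ht.2.trans hi⟩,
        pow_dvd_of_le_lowestNonzeroDigit hq ht.2⟩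

/-- Here m = k - u and d = (q^m - h) q^(u-1). The divisions for i < u are exact; for i = u + t the
term is q^(m-1-t) - ⌊(h-1)/q^(t+1)⌋. -/
theorem sum_griesmer_add {q h u m : ℕ} (hq : 2 ≤ q) (hh : 0 < h) (hu : 1 ≤ u)
    (hm : h ≤ q ^ m) :
    ∑ i ∈ Finset.range (u + m), ((q ^ m - h) * q ^ (u - 1) / q ^ i + 1) +
        ∑ t ∈ Finset.Icc 1 m, (h - 1) / q ^ t =
      (q ^ m - h) * ∑ i ∈ Finset.range u, q ^ i + u + ∑ i ∈ Finset.range m, q ^ i := by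
  rw [Finset.sum_range_add, add_assoc]
  congr 1
  · rw [Finset.sum_add_distrib, Finset.mul_sum, ← Finset.sum_range_reflect
      (fun i => (q ^ m - h) * q ^ i)]
    simp only [Finset.sum_const, Finset.card_range, smul_eq_mul, mul_one]
    congr 1
    refine Finset.sum_congr rfl fun i hi => ?_
    rw [Finset.mem_range] at hi
    rw [← Nat.sub_add_cancel (show i ≤ u - 1 by omega), pow_add, ← mul_assoc,
      Nat.mul_div_cancel _ (Nat.pow_pos (by omega)), Nat.sub_add_cancel (by omega)]
  · rw [← Finset.Ico_succ_right_eq_Icc, Nat.succ_eq_succ, Nat.succ_eq_add_one,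
      Finset.sum_Ico_eq_sum_range, ← Finset.sum_range_reflect (fun i => q ^ i)]
    rw [Nat.add_sub_cancel, ← Finset.sum_add_distrib]
    refine Finset.sum_congr rfl fun t ht => ?_
    rw [Finset.mem_range] at ht
    have h1 : u + t = (u - 1) + (1 + t) := by omega
    have h2 : q ^ m = q ^ (1 + t) * q ^ (m - 1 - t) := by
      rw [← pow_add]; congr 1; omega
    have h3 := Nat.mul_sub_div (h - 1) (q ^ (1 + t)) (q ^ (m - 1 - t)) (by omega)
    rw [Nat.sub_add_cancel hh, ← h2] at h3
    have h4 : (h - 1) / q ^ (1 + t) < q ^ (m - 1 - t) :=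
      Nat.div_lt_of_lt_mul (by omega)
    rw [h1, pow_add q (u - 1), mul_comm (q ^ (u - 1)),
      Nat.mul_div_mul_right _ _ (Nat.pow_pos (by omega)), h3]
    omega

theorem length_lt_sum_griesmer {q h u k n : ℕ} (hq : 2 ≤ q) (hh : 0 < h) (hu : 1 ≤ u)
    (huk : u ≤ k) (hlt : h * q ^ (u - 1) < q ^ (k - 1))
    (hn : (q - 1) * n + h * (q ^ u - 1) = q ^ k - 1)
    (hopt : ∑ i ∈ Finset.Icc 1 (k - u), h / q ^ i < lowestNonzeroDigit q h + u) :
    n < ∑ i ∈ Finset.range k, ((q ^ (k - 1) - h * q ^ (u - 1)) / q ^ i + 1) := by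
  obtain ⟨m, rfl⟩ := Nat.exists_eq_add_of_le huk
  have h1 : q ^ (u + m - 1) = q ^ m * q ^ (u - 1) := by
    rw [← pow_add]; congr 1; omega
  rw [h1] at hlt
  have hm : h ≤ q ^ m := (Nat.lt_of_mul_lt_mul_right hlt).le
  rw [Nat.add_sub_cancel_left] at hopt
  have h2 := sum_pred_div_pow_add_lowestNonzeroDigit_le hq hh hm
  have h3 := sum_griesmer_add hq hh hu hm
  rw [h1, ← Nat.sub_mul]
  -- This is the length with q - 1 divided out, using q^(u+m) - 1 = q^m (q^u - 1) + (q^m - 1).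
  suffices n = (q ^ m - h) * ∑ i ∈ Finset.range u, q ^ i + ∑ i ∈ Finset.range m, q ^ i by
    omega
  refine Nat.eq_of_mul_eq_mul_left (show 0 < q - 1 by omega) ?_
  have hgeom : ∀ s, (q - 1) * ∑ i ∈ Finset.range s, q ^ i = q ^ s - 1 := fun s => by
    rw [mul_comm, geom_sum_mul_of_one_le (by omega)]
  rw [mul_add, mul_left_comm, hgeom, hgeom]
  obtain ⟨a, ha⟩ := Nat.exists_eq_add_of_le hm
  have hqu : 1 ≤ q ^ u := Nat.one_le_pow _ _ (by omega)
  have hqm : 1 ≤ q ^ m := Nat.one_le_pow _ _ (by omega)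
  obtain ⟨b, hb⟩ := Nat.exists_eq_add_of_le hqu
  obtain ⟨c, hc⟩ := Nat.exists_eq_add_of_le hqm
  have h5 : q ^ (u + m) - 1 = c + q ^ m * b := by
    have : (1 + b) * (1 + c) = 1 + (c + (1 + c) * b) := by ring
    rw [pow_add, hb, hc, this, Nat.add_sub_cancel_left]
  rw [h5] at hn
  rw [show q ^ m - h = a by omega, show q ^ u - 1 = b by omega, show q ^ m - 1 = c by omega]
  rw [show q ^ u - 1 = b by omega, ha, add_mul] at hn
  omega

/-! ### Optimality and weight distribution -/

section

variable {F : Type*} [Field F] [Fintype F] [DecidableEq F] {k u h n : ℕ}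
  {f : Fin h × Fin u → Fin k} {G : Matrix (Fin k) (Fin n) F}

theorem codeMinDist_codeOfMatrix (hf : Function.Injective f) (hh : 0 < h) (hu : 1 ≤ u)
    (hk : 1 ≤ k)
    (hG : PicksOneFromEachClass G (outsideVectors fun i => LinearMap.range (blockIncl F f i)))
    (hinj : Function.Injective (Matrix.vecMulLinear G)) :
    codeMinDist (codeOfMatrix G) =
      Fintype.card F ^ (k - 1) - h * Fintype.card F ^ (u - 1) := by
  -- The all-ones vector is nonzero on every block, so it attains b(x) = h.
  let x : Fin k → F := fun _ => 1
  have hx : x ≠ 0 := fun h0 => one_ne_zero (congrFun h0 (f (⟨0, hh⟩, ⟨0, hu⟩)))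
  have hbx : blockWeight f x = h := by
    unfold blockWeight
    rw [Finset.filter_true_of_mem, Finset.card_univ, Fintype.card_fin]
    exact fun i _ h0 => one_ne_zero (congrFun h0 ⟨0, hu⟩ : (1 : F) = 0)
  have hwx := hammingNorm_vecMul_add hf hu hk hG hx
  rw [hbx, mul_comm] at hwx
  have hmem : ∃ a ∈ codeOfMatrix G, ∃ b ∈ codeOfMatrix G, a ≠ b ∧ hammingDist a b =
      Fintype.card F ^ (k - 1) - h * Fintype.card F ^ (u - 1) := by
    refine ⟨Matrix.vecMulLinear G x, ⟨x, rfl⟩, 0, Submodule.zero_mem _, ?_, ?_⟩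
    · exact fun h0 => hx (hinj (h0.trans (map_zero _).symm))
    · rw [hammingDist_zero_right, Matrix.vecMulLinear_apply]
      omega
  refine le_antisymm (Nat.sInf_le hmem) (le_csInf ⟨_, hmem⟩ ?_)
  rintro s ⟨_, ⟨y, rfl⟩, _, ⟨z, rfl⟩, hne, rfl⟩
  have hyz : -y + z ≠ 0 := fun h0 => hne (by rw [neg_add_eq_zero.1 h0])
  have hw := hammingNorm_vecMul_add hf hu hk hG hyz
  rw [hammingDist_eq_hammingNorm, ← map_neg, ← map_add, Matrix.vecMulLinear_apply]
  have := Nat.mul_le_mul_left (Fintype.card F ^ (u - 1)) (blockWeight_le (f := f) (-y + z))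
  rw [mul_comm h]
  omega

theorem isOptimalLinearCode_codeOfMatrix (hf : Function.Injective f) (hh : 0 < h)
    (hu : 1 ≤ u) (huk : u ≤ k)
    (hlt : h * Fintype.card F ^ (u - 1) < Fintype.card F ^ (k - 1))
    (hopt : ∑ i ∈ Finset.Icc 1 (k - u), h / Fintype.card F ^ i <
      lowestNonzeroDigit (Fintype.card F) h + u)
    (hG : PicksOneFromEachClass G (outsideVectors fun i => LinearMap.range (blockIncl F f i))) :
    IsOptimalLinearCode (codeOfMatrix G) k
      (Fintype.card F ^ (k - 1) - h * Fintype.card F ^ (u - 1)) := by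
  have hk : 1 ≤ k := hu.trans huk
  have hinj := vecMulLinear_injective hf hu hk hG hlt
  refine ⟨⟨?_, codeMinDist_codeOfMatrix hf hh hu hk hG hinj⟩, ?_⟩
  · rw [codeOfMatrix, LinearMap.finrank_range_of_inj hinj, Module.finrank_fin_fun]
  · rintro ⟨C', hC', hd⟩
    have hlen := length_lt_sum_griesmer Fintype.one_lt_card hh hu huk hlt (length_mul_add hf hG)
      hopt
    have hgr := griesmer_bound k
      (Fintype.card F ^ (k - 1) - h * Fintype.card F ^ (u - 1)) Finset.univ C' hC'.ge (by
        intro v hv hv0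
        have : codeMinDist C' ≤ hammingNorm v :=
          Nat.sInf_le ⟨v, hv, 0, C'.zero_mem, hv0, hammingDist_zero_right v⟩
        change _ < hammingNorm v
        omega)
    rw [Finset.card_univ, Fintype.card_fin] at hgr
    omega

/-- The condition x ≠ 0 is needed for m = 0: the zero vector also has b(x) = 0, but its codeword has
weight 0. -/
theorem hammingNorm_vecMul_eq_iff (hf : Function.Injective f) (hu : 1 ≤ u) (hk : 1 ≤ k)
    (hG : PicksOneFromEachClass G (outsideVectors fun i => LinearMap.range (blockIncl F f i)))
    (hlt : h * Fintype.card F ^ (u - 1) < Fintype.card F ^ (k - 1)) {m : ℕ} (hm : m ≤ h)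
    (x : Fin k → F) :
    hammingNorm (Matrix.vecMul x G) =
      Fintype.card F ^ (k - 1) - m * Fintype.card F ^ (u - 1) ↔
      x ≠ 0 ∧ blockWeight f x = m := by
  have hpos : 0 < Fintype.card F ^ (u - 1) := Nat.pow_pos Fintype.card_pos
  have hmlt := Nat.mul_le_mul_right (Fintype.card F ^ (u - 1)) hm
  by_cases hx : x = 0
  · subst hx
    simp only [Matrix.zero_vecMul, hammingNorm_zero, ne_eq, not_true_eq_false, false_and,
      iff_false]
    omega
  · have hw := hammingNorm_vecMul_add hf hu hk hG hx
    have hb := Nat.mul_le_mul_right (Fintype.card F ^ (u - 1)) (blockWeight_le (f := f) x)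
    rw [mul_comm] at hw
    simp only [ne_eq, hx, not_false_eq_true, true_and]
    rw [← Nat.mul_left_inj (b := blockWeight f x) (c := m) hpos.ne']
    omega

theorem weightMultiplicity_of_pos (hf : Function.Injective f) (hu : 1 ≤ u) (hk : 1 ≤ k)
    (hG : PicksOneFromEachClass G (outsideVectors fun i => LinearMap.range (blockIncl F f i)))
    (hlt : h * Fintype.card F ^ (u - 1) < Fintype.card F ^ (k - 1)) {m : ℕ} (hm : m ≤ h)
    (hm0 : 0 < m) :
    weightMultiplicity (codeOfMatrix G)
        (Fintype.card F ^ (k - 1) - m * Fintype.card F ^ (u - 1)) =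
      h.choose m * (Fintype.card F ^ u - 1) ^ m * Fintype.card F ^ (k - h * u) := by
  rw [weightMultiplicity_codeOfMatrix (vecMulLinear_injective hf hu hk hG hlt),
    ← card_blockWeight_eq hf]
  simp only [hammingNorm_vecMul_eq_iff hf hu hk hG hlt hm]
  congr 1
  ext x
  simp only [Finset.mem_filter, Finset.mem_univ, true_and, and_iff_right_iff_imp]
  rintro rfl rfl
  simp [blockWeight] at hm0

theorem weightMultiplicity_top (hf : Function.Injective f) (hu : 1 ≤ u) (hk : 1 ≤ k)
    (hG : PicksOneFromEachClass G (outsideVectors fun i => LinearMap.range (blockIncl F f i)))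
    (hlt : h * Fintype.card F ^ (u - 1) < Fintype.card F ^ (k - 1)) :
    weightMultiplicity (codeOfMatrix G) (Fintype.card F ^ (k - 1)) =
      Fintype.card F ^ (k - h * u) - 1 := by
  have h1 := hammingNorm_vecMul_eq_iff hf hu hk hG hlt (Nat.zero_le h)
  rw [zero_mul, Nat.sub_zero] at h1
  have h2 := card_blockWeight_eq (F := F) hf 0
  rw [Nat.choose_zero_right, pow_zero, one_mul, one_mul] at h2
  rw [weightMultiplicity_codeOfMatrix (vecMulLinear_injective hf hu hk hG hlt), ← h2,
    ← Finset.card_erase_of_mem (a := (0 : Fin k → F)) (by simp [blockWeight])]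
  congr 1
  ext x
  simp [h1]

theorem weightMultiplicity_zero (hf : Function.Injective f) (hu : 1 ≤ u) (hk : 1 ≤ k)
    (hG : PicksOneFromEachClass G (outsideVectors fun i => LinearMap.range (blockIncl F f i)))
    (hlt : h * Fintype.card F ^ (u - 1) < Fintype.card F ^ (k - 1)) :
    weightMultiplicity (codeOfMatrix G) 0 = 1 := by
  have hinj := vecMulLinear_injective hf hu hk hG hlt
  rw [weightMultiplicity_codeOfMatrix hinj, Finset.card_eq_one]
  refine ⟨0, ?_⟩
  ext x
  simp only [hammingNorm_eq_zero, Finset.mem_filter, Finset.mem_univ, true_and,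
    Finset.mem_singleton]
  rw [← Matrix.vecMulLinear_apply, map_eq_zero_iff _ hinj]

theorem weightMultiplicity_eq_zero (hf : Function.Injective f) (hu : 1 ≤ u) (hk : 1 ≤ k)
    (hG : PicksOneFromEachClass G (outsideVectors fun i => LinearMap.range (blockIncl F f i)))
    (hlt : h * Fintype.card F ^ (u - 1) < Fintype.card F ^ (k - 1)) {w : ℕ} (hw0 : w ≠ 0)
    (hw : ∀ x ≤ h, w ≠ Fintype.card F ^ (k - 1) - (h - x) * Fintype.card F ^ (u - 1)) :
    weightMultiplicity (codeOfMatrix G) w = 0 := by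
  rw [weightMultiplicity_codeOfMatrix (vecMulLinear_injective hf hu hk hG hlt),
    Finset.card_eq_zero, Finset.filter_eq_empty_iff]
  rintro x - rfl
  have hx : x ≠ 0 := by
    rintro rfl
    simp at hw0
  refine hw (h - blockWeight f x) (Nat.sub_le _ _) ?_
  rw [Nat.sub_sub_self (blockWeight_le x), hammingNorm_vecMul_eq_iff hf hu hk hG hlt
    (blockWeight_le x)]
  exact ⟨hx, rfl⟩

end

/-! ### Assembly of the main theorem -/

/-- Cancel q - 1, using q^k - q^(k-1) = (q-1) q^(k-1) and (q-1) q^(u-1) ≤ q^u - 1. This is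
positivity of d. -/
theorem mul_pow_pred_lt_of_gap {q k u h : ℕ} (hq : 2 ≤ q) (hu : 1 ≤ u) (hk : 1 ≤ k)
    (hgap : h * (q ^ u - 1) < q ^ k - q ^ (k - 1)) : h * q ^ (u - 1) < q ^ (k - 1) := by
  obtain ⟨u, rfl⟩ := Nat.exists_eq_add_of_le' hu
  obtain ⟨k, rfl⟩ := Nat.exists_eq_add_of_le' hk
  simp only [Nat.add_sub_cancel] at hgap ⊢
  have h1 : ∀ s, q ^ (s + 1) - q ^ s = (q - 1) * q ^ s := fun s => by
    rw [Nat.sub_mul, one_mul, pow_succ']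
  have h2 : (q - 1) * q ^ u ≤ q ^ (u + 1) - 1 := by
    rw [← h1]
    exact Nat.sub_le_sub_left (Nat.one_le_pow _ _ (by omega)) _
  rw [h1] at hgap
  refine Nat.lt_of_mul_lt_mul_left (a := q - 1) (lt_of_le_of_lt ?_ hgap)
  rw [mul_left_comm]
  exact Nat.mul_le_mul_left _ h2

theorem theorem2p4 {F : Type*} [Field F] [Fintype F] [DecidableEq F]
    (q k u h : ℕ) (hq : Fintype.card F = q) (hh : 0 < h) (hu : 2 ≤ u) (hk : h * u ≤ k)
    (hgap : q ^ k - q ^ (k - 1) > h * (q ^ u - 1))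
    (hopt : lowestNonzeroDigit q h + u > ∑ i ∈ Finset.Icc 1 (k - u), h / q ^ i) :
    -- such subspaces exist
    (∃ U : Fin h → Submodule F (Fin k → F), IsCoordFamily u U) ∧
    ∀ U : Fin h → Submodule F (Fin k → F), IsCoordFamily u U →
      -- a choice of representatives exists
      (∃ (n : ℕ) (G : Matrix (Fin k) (Fin n) F),
        PicksOneFromEachClass G (outsideVectors U)) ∧
      -- and every choice gives a code with the stated properties; no natural-number subtraction
      -- below truncates, since `hgap` forces `h * q ^ (u - 1) < q ^ (k - 1)`
      ∀ (n : ℕ) (G : Matrix (Fin k) (Fin n) F),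
        PicksOneFromEachClass G (outsideVectors U) →
        (n : ℚ) = (((q : ℚ) ^ k - 1) - h * ((q : ℚ) ^ u - 1)) / ((q : ℚ) - 1) ∧
        IsOptimalLinearCode (codeOfMatrix G) k (q ^ (k - 1) - h * q ^ (u - 1)) ∧
        -- weight distribution
        (weightMultiplicity (codeOfMatrix G) 0 = 1 ∧
          (∀ x : ℕ, x < h →
            weightMultiplicity (codeOfMatrix G) (q ^ (k - 1) - (h - x) * q ^ (u - 1)) =
              h.choose x * (q ^ u - 1) ^ (h - x) * q ^ (k - h * u)) ∧
          weightMultiplicity (codeOfMatrix G) (q ^ (k - 1)) = q ^ (k - h * u) - 1 ∧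
          (∀ w : ℕ, w ≠ 0 → (∀ x : ℕ, x ≤ h → w ≠ q ^ (k - 1) - (h - x) * q ^ (u - 1)) →
            weightMultiplicity (codeOfMatrix G) w = 0)) ∧
        -- generalized Hamming weights
        (∀ r : ℕ, 1 ≤ r → r ≤ u →
          (genHammingWeight (codeOfMatrix G) r : ℚ) =
            (((q : ℚ) ^ k - (q : ℚ) ^ (k - r)) - h * ((q : ℚ) ^ u - (q : ℚ) ^ (u - r))) /
              ((q : ℚ) - 1)) ∧
        (∀ r : ℕ, u ≤ r → r ≤ k →
          (genHammingWeight (codeOfMatrix G) r : ℚ) =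
            (((q : ℚ) ^ k - (q : ℚ) ^ (k - r)) - h * ((q : ℚ) ^ u - 1)) / ((q : ℚ) - 1)) := by
  subst hq
  have hq2 : 2 ≤ Fintype.card F := Fintype.one_lt_card
  have huk : u ≤ k := (Nat.le_mul_of_pos_left u hh).trans hk
  have hu1 : 1 ≤ u := by omega
  have hk1 : 1 ≤ k := by omega
  have hlt := mul_pow_pred_lt_of_gap hq2 hu1 hk1 hgap
  refine ⟨exists_isCoordFamily F hk, fun U hU => ⟨exists_picksOneFromEachClass U, ?_⟩⟩
  obtain ⟨f, hf, rfl⟩ := hU.exists_eq_range_blockIncl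
  intro n G hG
  have hinj := vecMulLinear_injective hf hu1 hk1 hG hlt
  have hq0 : (Fintype.card F : ℚ) ≠ 0 := by positivity
  have hq1 : (Fintype.card F : ℚ) - 1 ≠ 0 := by
    have : (2 : ℚ) ≤ Fintype.card F := by exact_mod_cast hq2
    linarith
  have hcast : ∀ s, ((Fintype.card F ^ s - 1 : ℕ) : ℚ) = (Fintype.card F : ℚ) ^ s - 1 :=
    fun s => by rw [Nat.cast_sub (Nat.one_le_pow _ _ (by omega))]; simp
  have hcast1 : ((Fintype.card F - 1 : ℕ) : ℚ) = (Fintype.card F : ℚ) - 1 := by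
    simpa using hcast 1
  -- One formula for both ranges of r: the quotient q^u q^(r-u) / q^r is q^(u-r) if r ≤ u and 1 if u
  -- ≤ r.
  have hgw : ∀ r ≤ k, (genHammingWeight (codeOfMatrix G) r : ℚ) =
      (((Fintype.card F : ℚ) ^ k - (Fintype.card F : ℚ) ^ (k - r)) -
        h * ((Fintype.card F : ℚ) ^ u -
          (Fintype.card F : ℚ) ^ u * (Fintype.card F : ℚ) ^ (r - u) /
            (Fintype.card F : ℚ) ^ r)) / ((Fintype.card F : ℚ) - 1) := by
    intro r hr
    have h1 := congrArg (Nat.cast : ℕ → ℚ)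
      (genHammingWeight_codeOfMatrix_formula hf hh hu1 hk1 hG hinj hr)
    simp only [Nat.cast_add, Nat.cast_mul, Nat.cast_pow, hcast1] at h1
    have h2 : (Fintype.card F : ℚ) ^ k =
        (Fintype.card F : ℚ) ^ (k - r) * (Fintype.card F : ℚ) ^ r := by
      rw [← pow_add, Nat.sub_add_cancel hr]
    rw [eq_div_iff hq1]
    field_simp
    linear_combination h1 - h2
  refine ⟨?_, isOptimalLinearCode_codeOfMatrix hf hh hu1 huk hlt hopt hG,
    ⟨weightMultiplicity_zero hf hu1 hk1 hG hlt, fun x hx => ?_,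
      weightMultiplicity_top hf hu1 hk1 hG hlt,
      fun w hw0 hw => weightMultiplicity_eq_zero hf hu1 hk1 hG hlt hw0 hw⟩,
    fun r _ hru => ?_, fun r hur hrk => ?_⟩
  · have h1 := congrArg (Nat.cast : ℕ → ℚ) (length_mul_add hf hG)
    simp only [Nat.cast_add, Nat.cast_mul, hcast, hcast1] at h1
    rw [eq_div_iff hq1]
    linear_combination h1
  -- Here x counts the blocks where the vector vanishes, while the lemma counts the others; hence
  -- the binomial symmetry.
  · rw [weightMultiplicity_of_pos hf hu1 hk1 hG hlt (Nat.sub_le _ _) (by omega),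
      Nat.choose_symm hx.le]
  · rw [hgw r (hru.trans huk), Nat.sub_eq_zero_of_le hru, pow_zero, mul_one,
      pow_sub₀ _ hq0 hru, ← div_eq_mul_inv ((Fintype.card F : ℚ) ^ u)]
  · rw [hgw r hrk, ← pow_add, Nat.add_sub_cancel' hur, div_self (pow_ne_zero _ hq0)]
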